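/- Let $K=\mathbb C((t))$ with its $t$-adic valuation $\mathrm{val}_t$, and let $X_K\subset\mathbb P^2_K$ be the Fermat cubic $t(x_0^3+x_1^3+x_2^3)=x_0x_1x_2$, with $L=\mathcal O(3)|_{X_K}$. Subscripts are taken modulo $3$. Let $\Delta\subset\mathbb R^2$ be the triangle with vertices $m_0=(-1,-1)$, $m_1=(-1,2)$, $m_2=(2,-1)$, and $\Delta^\vee$ the triangle with vertices $n_0=(-1,0)$, $n_1=(1,1)$, $n_2=(0,-1)$. **Valuations.** For $n=(1-r)n_j+rn_{j+1}\in\partial\Delta^\vee$, $r\in[0,1]$, let $\mathrm{val}_n$ be the valuation on the function field of $X_K$ obtained by expanding in $x=x_j/x_{j-1}$, $y=x_{j+1}/x_{j-1}$ (so that $t=xy/(1+x^3+y^3)$), with $\mathrm{val}_n\big(\sum c_{p,q}x^py^q\big)=\min\{(1-r)p+rq: c_{p,q}\ne0\}$ on $\mathbb C[[x,y]]$, extended to fractions. For a section $s$ of $L^{\ell}=\mathcal O(k)|_{X_K}$, $\ell=k/3$, put $\mathrm{val}_n(s)=\mathrm{val}_n(s/x_{j-1}^k)$. A family $(\theta_i)$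 in $H^0(X_K,L^\ell)$ is *valuatively independent* if for all $n\in\partial\Delta^\vee$ and all $a_i\in K$, almost all zero, $$\mathrm{val}_n\Big(\sum_i a_i\theta_i\Big)=\min\{\mathrm{val}_t(a_i)+\mathrm{val}_n(\theta_i): a_i\neq0\}.$$ **Cost function.** Let $\pi:\mathbb R\to\partial\Delta^\vee$, $\pi(u)=(i+1-u)n_i+(u-i)n_{i+1}$ for $u\in[i,i+1)$, $i\in\mathbb Z$, and $p:\mathbb R\to\partial\Delta$, $p(u^\vee)=(i+1-\tfrac{u^\vee}{3})m_i+(\tfrac{u^\vee}{3}-i)m_{i+1}$ for $u^\vee\in[3i,3(i+1))$. Let $\gamma(u,a)=(u-3,\,a-9u+9)$ act on $\mathbb R\times\mathbb R$, hence on functions $s:\mathbb R\to\mathbb R$ (through their graphs) by $\gamma\cdot s=\gamma\circ s\circ\gamma^{-1}$. Put $$[u,u^\vee]=\sup_{j\in\mathbb Z}(\gamma^j\cdot s_{u^\vee})(u),\quad s_{u^\vee}(u)=u^\vee u,$$ $$\Phi_0(u)=-\langle m_i,\pi(u)\rangle+3iu-\tfrac{3i(i-1)}2\ \text{ for } i=\lfloor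 u\rfloor,\qquad \Phi_0^\star(u^\vee)=\sup_{u\in\mathbb R}\big([u,u^\vee]-\Phi_0(u)\big).$$ The function $-[u,u^\vee]+\Phi_0(u)+\Phi_0^\star(u^\vee)$ is invariant under $u\mapsto u+3$ and under $u^\vee\mapsto u^\vee+9$, and so induces through $p$ and $\pi$ a function $c:\partial\Delta\times\partial\Delta^\vee\to\mathbb R$. **Proposition.** Let $k\ge1$ be an integer, $\ell=k/3$, and $\partial\Delta_\ell=\partial\Delta\cap(m_0+\ell^{-1}\mathbb Z^2)$. Suppose that $(s_m)_{m\in\partial\Delta_\ell}$ is a basis of the $K$-vector space $H^0(X_K,L^\ell)$ such that $$\ell^{-1}\,\mathrm{val}_n(s_m)=c(m,n)\qquad\text{for all } n\in\partial\Delta^\vee,\ m\in\partial\Delta_\ell .$$ Then the basis $(s_m)_{m\in\partial\Delta_\ell}$ is valuatively independent. -/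

import Mathlib

namespace FermatFamily

noncomputable section

/-! The two triangles and the boundary of the dual one. Subscripts are taken modulo 3. -/

/-- The vertices `m₀ = -e₁-e₂`, `m₁ = -e₁+2e₂`, `m₂ = 2e₁-e₂` of the triangle `Δ`. -/
def mVert : ZMod 3 → (Fin 2 → ℝ) :=
  ![![-1, -1], ![-1, 2], ![2, -1]]

/-- The vertices `n₀ = -e₁*`, `n₁ = e₁*+e₂*`, `n₂ = -e₂*` of the triangle `Δ*`. -/
def nVert : ZMod 3 → (Fin 2 → ℝ) :=
  ![![-1, 0], ![1, 1], ![0, -1]]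

/-- The boundary `∂Δ`, the union of the three edges of `Δ`. -/
def bdryDelta : Set (Fin 2 → ℝ) :=
  ⋃ i : ZMod 3, segment ℝ (mVert i) (mVert (i + 1))

/-- `∂Δ_ℓ = ∂Δ ∩ (m₀ + ℓ⁻¹ ℤ²)`. -/
def bdryLattice (l : ℚ) : Set (Fin 2 → ℝ) :=
  {m | m ∈ bdryDelta ∧ ∃ z : Fin 2 → ℤ, m = mVert 0 + fun i => ((l : ℝ)⁻¹ * (z i : ℝ))}

/-- The point `(1-r) n_j + r n_{j+1}` of the edge `[n_j, n_{j+1}]` of `∂Δ*`. -/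
def edgePoint (j : ZMod 3) (r : ℝ) : Fin 2 → ℝ :=
  (1 - r) • nVert j + r • nVert (j + 1)

/-- For `t ∈ [k, k+1)`, the point `(k+1-t) v_k + (t-k) v_{k+1}`. -/
def polyline (v : ZMod 3 → (Fin 2 → ℝ)) (t : ℝ) : Fin 2 → ℝ :=
  ((⌊t⌋ : ℝ) + 1 - t) • v ((⌊t⌋ : ℤ) : ZMod 3) + (t - (⌊t⌋ : ℝ)) • v ((⌊t⌋ + 1 : ℤ) : ZMod 3)

/-- The universal covering `π : ℝ → M = ∂Δ*`. -/
def coverM (t : ℝ) : Fin 2 → ℝ := polyline nVert t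

/-- The universal covering `p : ℝ → M⋆ = ∂Δ`, of period 9. -/
def coverMdual (tv : ℝ) : Fin 2 → ℝ := polyline mVert (tv / 3)

/-! The cost function. The affine bundle `L → ∂Δ*` has a trivialisation `L_k` over the star of `n_k`,
and `L_{k+1}` is obtained from `L_k` by adding `-⟨m_{k+1} - m_k, n⟩`. Its pullback to the universal
cover `ℝ` is identified with `ℝ × ℝ` through the trivialisation `L_0`. -/

/-- The amount that passes from the trivialisation `L_k` to `L_0` over the universal cover. It
vanishes for `k = 0`, and the increment from `k` to `k + 1` is the affine function `3t - 3k`, which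
is equal to `⟨m_{k+1} - m_k, π(t)⟩` for `t ∈ [k, k+1]`. -/
def glue (k : ℤ) (t : ℝ) : ℝ := 3 * k * t - 3 * k * (k - 1) / 2

/-- The section `Φ₀` of `L`, equal to `n ↦ -⟨m_k, n⟩` over the star of `n_k`, read in the
trivialisation of the pullback to `ℝ`. -/
def Phi0 (t : ℝ) : ℝ :=
  -(mVert ((⌊t⌋ : ℤ) : ZMod 3) ⬝ᵥ coverM t) + glue ⌊t⌋ t

/-- The action on the pullback of `L` of the positive generator `γ` of the fundamental group `ℤ`. -/
def deck : Equiv.Perm (ℝ × ℝ) where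
  toFun x := (x.1 - 3, x.2 - 9 * x.1 + 9)
  invFun x := (x.1 + 3, x.2 + 9 * x.1 + 18)
  left_inv x := by ext <;> (simp; try ring)
  right_inv x := by ext <;> (simp; try ring)

/-- The section `γ^j · s = γ^j ∘ s ∘ γ^{-j}`. On the base, `γ^{-j}` sends `t` to `t + 3j`. -/
def deckAct (j : ℤ) (s : ℝ → ℝ) (t : ℝ) : ℝ :=
  ((deck ^ j) (t + 3 * j, s (t + 3 * j))).2

/-- The canonical pairing `[t, t*] = sup_γ (γ · s)(t) - s` for the affine section `s(t) = t* t`. -/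
def pairing (t tv : ℝ) : ℝ :=
  ⨆ j : ℤ, deckAct j (fun u => tv * u) t

/-- The Legendre transform of `Φ₀`. -/
def Phi0Star (tv : ℝ) : ℝ := ⨆ t : ℝ, (pairing t tv - Phi0 t)

/-- The cost function on the universal covers. -/
def costLift (tv t : ℝ) : ℝ := -pairing t tv + Phi0 t + Phi0Star tv

/-- The cost function `c(m, n)` for `m ∈ ∂Δ`, `n ∈ ∂Δ*`: the function induced by `costLift`, which is
invariant under `t ↦ t + 3` and under `t* ↦ t* + 9`. -/
def cost (m n : Fin 2 → ℝ) : ℝ :=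
  costLift (Function.invFun coverMdual m) (Function.invFun coverM n)

/-! The curve `X_K` and the sections of `L^ℓ = 𝒪(k)`, `ℓ = k/3`. -/

/-- `K = ℂ((t))`. -/
def K : Type := LaurentSeries ℂ

instance : Field K := inferInstanceAs (Field (LaurentSeries ℂ))

/-- The identification of `K` with Mathlib's field of Laurent series. -/
def KEquiv : K ≃+* LaurentSeries ℂ := RingEquiv.refl (LaurentSeries ℂ)

/-- The parameter `t` of `K`. -/
def tK : K := KEquiv.symm (HahnSeries.single 1 1)

/-- The `t`-adic valuation of a nonzero element of `K`. -/
def valT (a : K) : ℤ := HahnSeries.order (KEquiv a)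

/-- The equation of `X_K`. -/
def cubic : MvPolynomial (ZMod 3) K :=
  MvPolynomial.C tK * (MvPolynomial.X 0 ^ 3 + MvPolynomial.X 1 ^ 3 + MvPolynomial.X 2 ^ 3)
    - MvPolynomial.X 0 * MvPolynomial.X 1 * MvPolynomial.X 2

/-- The homogeneous coordinate ring of `X_K ⊆ ℙ²_K`. -/
abbrev CoordRing : Type := MvPolynomial (ZMod 3) K ⧸ Ideal.span {cubic}

/-- The class of a polynomial in the fraction field of the homogeneous coordinate ring. -/
def toFrac : MvPolynomial (ZMod 3) K →ₐ[K] FractionRing CoordRing :=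
  (IsScalarTower.toAlgHom K CoordRing (FractionRing CoordRing)).comp
    (Ideal.Quotient.mkₐ K (Ideal.span {cubic}))

/-- The global sections of `𝒪(k)` on `X_K`: the elements of the fraction field of the homogeneous
coordinate ring that on each chart `{x_i ≠ 0}` have the form `P / x_i ^ N` with `P` homogeneous of
degree `k + N`. -/
def H0 (k : ℕ) : Submodule K (FractionRing CoordRing) where
  carrier := {z | ∀ i : ZMod 3, ∃ (P : MvPolynomial (ZMod 3) K) (N : ℕ),
    P.IsHomogeneous (k + N) ∧ z * toFrac (MvPolynomial.X i) ^ N = toFrac P}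
  zero_mem' := fun i => ⟨0, 0, MvPolynomial.isHomogeneous_zero _ _ _, by simp⟩
  add_mem' := by
    intro z w hz hw i
    obtain ⟨P, N, hP, hzP⟩ := hz i
    obtain ⟨Q, M, hQ, hwQ⟩ := hw i
    refine ⟨P * MvPolynomial.X i ^ M + Q * MvPolynomial.X i ^ N, N + M, ?_, ?_⟩
    · refine MvPolynomial.IsHomogeneous.add ?_ ?_
      · have h := hP.mul (MvPolynomial.isHomogeneous_X_pow (R := K) i M)
        rwa [add_assoc] at h
      · have h := hQ.mul (MvPolynomial.isHomogeneous_X_pow (R := K) i N)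
        rwa [add_assoc, add_comm M N] at h
    · simp only [map_add, map_mul, map_pow, ← hzP, ← hwQ]
      ring
  smul_mem' := by
    intro c z hz i
    obtain ⟨P, N, hP, hzP⟩ := hz i
    refine ⟨c • P, N, ?_, ?_⟩
    · rw [MvPolynomial.smul_eq_C_mul]
      have h := (MvPolynomial.isHomogeneous_C (ZMod 3) c).mul hP
      rwa [zero_add] at h
    · rw [smul_mul_assoc, hzP, map_smul]

/-! The valuations. Near the corner `{x_j = x_{j+1} = 0}` of the central fibre, the functions
`x = x_j / x_{j-1}` and `y = x_{j+1} / x_{j-1}` are coordinates on the total space of the family, and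
`t = x y / (1 + x³ + y³)`. -/

/-- The field of fractions of `ℂ[[x, y]]`. -/
abbrev LocalField : Type := FractionRing (MvPowerSeries (Fin 2) ℂ)

/-- The power series `x y / (1 + x³ + y³)`. -/
def tSeries : MvPowerSeries (Fin 2) ℂ :=
  MvPowerSeries.X 0 * MvPowerSeries.X 1 *
    (1 + MvPowerSeries.X 0 ^ 3 + MvPowerSeries.X 1 ^ 3)⁻¹

theorem hasSubst_tSeries : PowerSeries.HasSubst tSeries :=
  PowerSeries.HasSubst.of_constantCoeff_zero (by simp [tSeries])

theorem tSeries_ne_zero : tSeries ≠ 0 := by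
  have hX : ∀ i : Fin 2, (MvPowerSeries.X i : MvPowerSeries (Fin 2) ℂ) ≠ 0 := by
    intro i h
    have := congrArg (MvPowerSeries.coeff (Finsupp.single i 1)) h
    simp [MvPowerSeries.coeff_X] at this
  refine mul_ne_zero (mul_ne_zero (hX 0) (hX 1)) ?_
  intro h
  rw [MvPowerSeries.inv_eq_zero] at h
  simp at h

/-- The substitution `f(t) ↦ f(x y / (1 + x³ + y³))` on `ℂ[[t]]`. -/
def powerSeriesToLocal : PowerSeries ℂ →+* LocalField :=
  (algebraMap (MvPowerSeries (Fin 2) ℂ) LocalField).comp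
    (PowerSeries.substAlgHom (R := ℂ) hasSubst_tSeries).toRingHom

theorem isUnit_powerSeriesToLocal_X : IsUnit (powerSeriesToLocal PowerSeries.X) := by
  have h : powerSeriesToLocal PowerSeries.X = algebraMap _ LocalField tSeries := by
    change algebraMap _ LocalField (PowerSeries.substAlgHom hasSubst_tSeries PowerSeries.X) = _
    rw [PowerSeries.coe_substAlgHom, PowerSeries.subst_X hasSubst_tSeries]
  rw [h, isUnit_iff_ne_zero]
  simpa using tSeries_ne_zero

/-- The substitution `t ↦ x y / (1 + x³ + y³)` on `K = ℂ((t))`. -/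
def KToLocal : K →+* LocalField :=
  (IsLocalization.Away.lift (S := LaurentSeries ℂ) (PowerSeries.X : PowerSeries ℂ)
    isUnit_powerSeriesToLocal_X).comp (KEquiv : K →+* LaurentSeries ℂ)

/-- The expansion of a polynomial at the corner `{x_j = x_{j+1} = 0}`: `x_j ↦ x`, `x_{j+1} ↦ y` and
`x_{j-1} ↦ 1`. It kills the equation of `X_K`. -/
def expandPoly (j : ZMod 3) : MvPolynomial (ZMod 3) K →+* LocalField :=
  MvPolynomial.eval₂Hom KToLocal fun i =>
    if i = j then algebraMap (MvPowerSeries (Fin 2) ℂ) LocalField (MvPowerSeries.X 0)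
    else if i = j + 1 then algebraMap (MvPowerSeries (Fin 2) ℂ) LocalField (MvPowerSeries.X 1)
    else 1

/-- The expansion at the corner `{x_j = x_{j+1} = 0}` of `s / τ`, where `τ = x_{j-1}^k`: if
`s = P / x_{j-1}^N`, it is the expansion of `P`, whatever the choice of `P` and `N`. -/
def expand (k : ℕ) (j : ZMod 3) (s : H0 k) : LocalField :=
  expandPoly j (s.2 (j - 1)).choose

/-- The monomial valuation `min {(1-r) p + r q : c_{p,q} ≠ 0}` of `∑ c_{p,q} x^p y^q`. -/
def monomialVal (r : ℝ) (f : MvPowerSeries (Fin 2) ℂ) : EReal :=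
  ⨅ (d : Fin 2 →₀ ℕ) (_ : MvPowerSeries.coeff d f ≠ 0),
    (((1 - r) * (d 0 : ℝ) + r * (d 1 : ℝ) : ℝ) : EReal)

/-- The extension of the monomial valuation to fractions, `v(f / g) = v(f) - v(g)`. -/
def localVal (r : ℝ) (z : LocalField) : EReal :=
  monomialVal r (IsLocalization.sec (nonZeroDivisors (MvPowerSeries (Fin 2) ℂ)) z).1
    - monomialVal r (IsLocalization.sec (nonZeroDivisors (MvPowerSeries (Fin 2) ℂ)) z).2

/-- `val_n(s) = val_n(s / τ)` for `n = (1-r) n_j + r n_{j+1}`. -/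
def val (k : ℕ) (j : ZMod 3) (r : ℝ) (s : H0 k) : EReal :=
  localVal r (expand k j s)

/-- Valuative independence of a family `θ` of sections of `𝒪(k)`: at every point
`n = (1-r) n_j + r n_{j+1}` of `∂Δ*`, and for all coefficients `a_i ∈ K`, almost all zero,
`val_n(∑ a_i θ_i) = min {val_t(a_i) + val_n(θ_i) : a_i ≠ 0}`. -/
def ValuativelyIndependent {ι : Type*} (k : ℕ) (θ : ι → H0 k) : Prop :=
  ∀ (j : ZMod 3) (r : ℝ), r ∈ Set.Icc (0 : ℝ) 1 → ∀ a : ι →₀ K,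
    val k j r (Finsupp.linearCombination K θ a) =
      a.support.inf fun i => (((valT (a i) : ℤ) : ℝ) : EReal) + val k j r (θ i)

end

end FermatFamily

namespace FermatFamily

/-! If the terms `a_m s_m` of a combination have pairwise distinct valuations, the least one
dominates and the valuation of the sum is the minimum. This happens at every point `n = (1-r) n_j +
r n_{j+1}` with `r` irrational. There, distinct monomials `x^p y^q` have distinct weights, so the
monomial valuation is multiplicative (`monomialOrd_mul`) and extends to a genuine valuation of the
fraction field (`localAddValuation`). It restricts to `val_t` on `K` (`localOrd_KToLocal`), so
coefficients shift valuations by integers only. For a lift `t` of `n`, the cost `c(m, n)` is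
`Φ₀(t)`, common to all `m`, plus an affine expression in `t` with rational coefficients whose slope
determines `m`. Since `t` is irrational, the costs of two distinct lattice points differ by an
irrational number (`irrational_cost_sub_cost`). As `ℓ` is rational, the valuations of `s_m` and
`s_m'` are incongruent modulo `ℤ`. At the remaining points valuations may collide. But both sides of
the required identity are continuous in `r` (`continuousOn_localVal`), because finitely many
exponents of a power series compute its monomial valuation for all `r` at once. Irrational
parameters are dense, so the identity extends (`valuativelyIndependent_of_irrational`). -/

/-! ### The pairing, `Φ₀` and its Legendre transform in closed form. -/

theorem deck_zpow (j : ℤ) (x : ℝ × ℝ) :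
    (deck ^ j) x = (x.1 - 3 * j, x.2 + 9 * j - 9 * j * x.1 + 27 * j * (j - 1) / 2) := by
  induction j using Int.induction_on generalizing x with
  | zero => simp
  | succ n ih =>
    rw [zpow_add_one, Equiv.Perm.mul_apply, ih]
    ext <;> simp [deck] <;> ring
  | pred n ih =>
    rw [zpow_sub_one, Equiv.Perm.mul_apply, ih]
    ext <;> simp [deck, Equiv.Perm.inv_def, Equiv.symm] <;> ring

theorem deckAct_linear (j : ℤ) (tv t : ℝ) :
    deckAct j (fun u => tv * u) t = (tv - 9 * j) * t + 3 * j * tv - 27 * j ^ 2 / 2 - 9 * j / 2 := by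
  simp only [deckAct, deck_zpow]
  ring

/-- A concave quadratic function attains its maximum over the integers. -/
theorem exists_int_forall_concave_le {A : ℝ} (hA : 0 < A) (B : ℝ) :
    ∃ h : ℤ, ∀ j : ℤ, B * j - A * (j : ℝ) ^ 2 ≤ B * h - A * (h : ℝ) ^ 2 := by
  -- The vertex of the parabola is `B / (2A)`; the integer nearest to it is optimal.
  refine ⟨round (B / (2 * A)), fun j => ?_⟩
  have key : |B / (2 * A) - round (B / (2 * A))| ≤ |B / (2 * A) - j| := round_le _ _
  have h2 := sq_le_sq.mpr key
  have hB : B = 2 * A * (B / (2 * A)) := by field_simp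
  set c := B / (2 * A)
  rw [hB]
  nlinarith

/-- The branches are concave quadratic in `j`, so the supremum is a maximum: at each `t` the pairing
is one branch, affine in `t` of slope `tv - 9h`. -/
theorem exists_pairing_eq (t tv : ℝ) :
    ∃ h : ℤ, pairing t tv = (tv - 9 * h) * t + 3 * h * tv - 27 * h ^ 2 / 2 - 9 * h / 2 ∧
      ∀ j : ℤ, (tv - 9 * j) * t + 3 * j * tv - 27 * j ^ 2 / 2 - 9 * j / 2 ≤ pairing t tv := by
  obtain ⟨h, hh⟩ := exists_int_forall_concave_le (A := 27 / 2) (by norm_num)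
    (3 * tv - 9 * t - 9 / 2)
  have hle : ∀ j : ℤ, deckAct j (fun u => tv * u) t ≤ deckAct h (fun u => tv * u) t := by
    intro j
    rw [deckAct_linear, deckAct_linear]
    linarith [hh j]
  have heq : pairing t tv = deckAct h (fun u => tv * u) t :=
    le_antisymm (ciSup_le hle) (le_ciSup (f := fun j : ℤ => deckAct j (fun u => tv * u) t)
      ⟨_, Set.forall_mem_range.mpr hle⟩ h)
  refine ⟨h, by rw [heq, deckAct_linear], fun j => ?_⟩
  rw [heq, ← deckAct_linear]
  exact hle j

theorem zmod_three_cases (i : ZMod 3) : i = 0 ∨ i = 1 ∨ i = 2 := by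
  revert i; decide

theorem mVert_zero : mVert 0 = ![-1, -1] := rfl
theorem mVert_one : mVert 1 = ![-1, 2] := rfl
theorem mVert_two : mVert 2 = ![2, -1] := rfl
theorem nVert_zero : nVert 0 = ![-1, 0] := rfl
theorem nVert_one : nVert 1 = ![1, 1] := rfl
theorem nVert_two : nVert 2 = ![0, -1] := rfl

theorem mVert_dotProduct_nVert (i : ZMod 3) : mVert i ⬝ᵥ nVert i = 1 := by
  rcases zmod_three_cases i with rfl | rfl | rfl
  · rw [mVert_zero, nVert_zero]; norm_num [dotProduct, Fin.sum_univ_two]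
  · rw [mVert_one, nVert_one]; norm_num [dotProduct, Fin.sum_univ_two]
  · rw [mVert_two, nVert_two]; norm_num [dotProduct, Fin.sum_univ_two]

theorem mVert_dotProduct_nVert_succ (i : ZMod 3) : mVert i ⬝ᵥ nVert (i + 1) = -2 := by
  rcases zmod_three_cases i with rfl | rfl | rfl
  · rw [mVert_zero, zero_add, nVert_one]; norm_num [dotProduct, Fin.sum_univ_two]
  · rw [mVert_one, one_add_one_eq_two, nVert_two]; norm_num [dotProduct, Fin.sum_univ_two]
  · rw [mVert_two, show (2 + 1 : ZMod 3) = 0 from rfl, nVert_zero]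
    norm_num [dotProduct, Fin.sum_univ_two]

/-- `Φ₀` is piecewise affine with breaks at the integers, its slope jumping from `3i` to `3(i+1)` at
`i`. -/
theorem Phi0_eq (t : ℝ) :
    Phi0 t = -1 + 3 * ⌊t⌋ * (⌊t⌋ + 1) / 2 + 3 * (⌊t⌋ + 1) * (t - ⌊t⌋) := by
  simp only [Phi0, coverM, polyline, glue, dotProduct_add, dotProduct_smul, Int.cast_add,
    Int.cast_one, mVert_dotProduct_nVert, mVert_dotProduct_nVert_succ, smul_eq_mul]
  ring

theorem Phi0_intCast (i : ℤ) : Phi0 i = -1 + 3 * i * (i + 1) / 2 := by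
  simp [Phi0_eq]

/-- A line of slope in `[3i, 3(i+1)]` through the point of the graph of `Φ₀` over `i` supports the
graph from below. -/
theorem Phi0_support {i : ℤ} {q : ℝ} (h1 : 3 * i ≤ q) (h2 : q ≤ 3 * (i + 1)) (t : ℝ) :
    q * (t - i) + Phi0 i ≤ Phi0 t := by
  rw [Phi0_intCast, Phi0_eq]
  have hd0 := Int.floor_le t
  have hd1 := Int.lt_floor_add_one t
  set n := ⌊t⌋
  -- A product of two consecutive integers is nonnegative; this encodes the convexity of `Φ₀` along
  -- the integers.
  have hnn : 0 ≤ ((i : ℝ) - n - 1) * (i - n - 2) := by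
    have : 0 ≤ (i - n - 1) * (i - n - 2) := by
      rcases le_or_gt i (n + 1) with h | h <;> nlinarith
    exact_mod_cast this
  have hnm : 0 ≤ ((n : ℝ) - i) * (n - i - 1) := by
    have : 0 ≤ (n - i) * (n - i - 1) := by
      rcases le_or_gt n i with h | h <;> nlinarith
    exact_mod_cast this
  rcases le_or_gt i n with h | h
  · have h' : (i : ℝ) ≤ n := by exact_mod_cast h
    nlinarith [mul_nonneg (sub_nonneg.mpr h2) (sub_nonneg.mpr (h'.trans hd0)),
      mul_nonneg (sub_nonneg.mpr h') (sub_nonneg.mpr hd0)]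
  · have h' : (n : ℝ) + 1 ≤ i := by exact_mod_cast h
    nlinarith [mul_nonneg (sub_nonneg.mpr h1) (sub_nonneg.mpr (hd1.le.trans h')),
      mul_nonneg (sub_nonneg.mpr h') (sub_nonneg.mpr hd1.le)]

/-- By convexity, a line of slope `tv` supports `Φ₀` at the integer `⌊tv / 3⌋`. The closed form is
needed only to see that rational `tv` give rational values. -/
theorem Phi0Star_eq (tv : ℝ) :
    Phi0Star tv = tv * ⌊tv / 3⌋ + 1 - 3 * ⌊tv / 3⌋ * (⌊tv / 3⌋ + 1) / 2 := by
  have hi1 := Int.floor_le (tv / 3)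
  have hi2 := Int.lt_floor_add_one (tv / 3)
  set i := ⌊tv / 3⌋
  have hle : ∀ t : ℝ, pairing t tv - Phi0 t ≤ tv * i + 1 - 3 * i * (i + 1) / 2 := by
    intro t
    obtain ⟨h, hp, -⟩ := exists_pairing_eq t tv
    -- The branch `h` has slope `tv - 9h`, hence supports `Φ₀` at `i - 3h`; every branch yields the
    -- same bound.
    have hs := Phi0_support (i := i - 3 * h) (q := tv - 9 * h)
      (by push_cast; linarith) (by push_cast; linarith) t
    rw [Phi0_intCast] at hs
    push_cast at hs
    rw [hp]
    nlinarith
  refine le_antisymm (ciSup_le hle) ?_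
  refine le_trans ?_ (le_ciSup (f := fun t : ℝ => pairing t tv - Phi0 t)
    ⟨_, Set.forall_mem_range.mpr hle⟩ (i : ℝ))
  -- The bound is attained at `t = i`, already by the branch `j = 0`.
  obtain ⟨h, -, hp⟩ := exists_pairing_eq i tv
  have := hp 0
  simp only [Phi0_intCast]
  push_cast at this
  linarith

theorem exists_rat_Phi0Star {tv : ℝ} (htv : tv ∈ Set.range ((↑) : ℚ → ℝ)) :
    Phi0Star tv ∈ Set.range ((↑) : ℚ → ℝ) := by
  obtain ⟨q, rfl⟩ := htv
  refine ⟨q * ⌊(q : ℝ) / 3⌋ + 1 - 3 * ⌊(q : ℝ) / 3⌋ * (⌊(q : ℝ) / 3⌋ + 1) / 2, ?_⟩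
  rw [Phi0Star_eq]
  push_cast
  rfl

/-! The coverings. -/

theorem polyline_add_three (v : ZMod 3 → (Fin 2 → ℝ)) (t : ℝ) (h : ℤ) :
    polyline v (t + 3 * h) = polyline v t := by
  have hf : ⌊t + 3 * (h : ℝ)⌋ = ⌊t⌋ + 3 * h := by
    have := Int.floor_add_intCast t (3 * h)
    push_cast at this
    exact this
  have h3 : (3 : ZMod 3) = 0 := rfl
  simp only [polyline, hf]
  push_cast
  simp only [h3, zero_mul, add_zero]
  congr 2 <;> ring

theorem polyline_natCast_add (v : ZMod 3 → (Fin 2 → ℝ)) (i : ZMod 3) {r : ℝ} (h0 : 0 ≤ r)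
    (h1 : r ≤ 1) : polyline v (i.val + r) = (1 - r) • v i + r • v (i + 1) := by
  rcases h1.lt_or_eq with h1 | rfl
  · have hf : ⌊(i.val : ℝ) + r⌋ = i.val := by
      rw [Int.floor_eq_iff]
      push_cast
      constructor <;> linarith
    simp only [polyline, hf]
    push_cast
    rw [ZMod.natCast_zmod_val]
    congr 2 <;> ring
  -- At `r = 1` the floor jumps to the next edge, whose initial vertex is the same point.
  · have hf : ⌊(i.val : ℝ) + 1⌋ = i.val + 1 := by
      rw [Int.floor_eq_iff]
      push_cast
      constructor <;> linarith
    simp only [polyline, hf]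
    push_cast
    rw [ZMod.natCast_zmod_val]
    simp

/-- The lift chosen by `Function.invFun` is arbitrary; all that is used later is that it lies over
the given point. -/
theorem coverM_invFun_edgePoint (j : ZMod 3) {r : ℝ} (hr : r ∈ Set.Icc (0 : ℝ) 1) :
    coverM (Function.invFun coverM (edgePoint j r)) = edgePoint j r :=
  Function.invFun_eq ⟨_, polyline_natCast_add nVert j hr.1 hr.2⟩

theorem coverMdual_invFun {m : Fin 2 → ℝ} (hm : m ∈ bdryDelta) :
    coverMdual (Function.invFun coverMdual m) = m := by
  apply Function.invFun_eq
  obtain ⟨i, a, b, ha, hb, hab, rfl⟩ := Set.mem_iUnion.mp hm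
  refine ⟨3 * (i.val + b), ?_⟩
  rw [coverMdual, mul_div_cancel_left₀ _ (by norm_num), polyline_natCast_add _ _ hb (by linarith)]
  rw [← hab, add_sub_cancel_right]

/-! ### Rational and irrational parameters on the edges. -/

/-- A point with rational coordinates on the line through two distinct points with rational
coordinates has a rational parameter. -/
theorem mem_range_ratCast_of_edge {p q : Fin 2 → ℝ} (hp : ∀ a, p a ∈ Set.range ((↑) : ℚ → ℝ))
    (hq : ∀ a, q a ∈ Set.range ((↑) : ℚ → ℝ)) (hpq : p ≠ q) {r : ℝ}
    (h : ∀ a, ((1 - r) • p + r • q) a ∈ Set.range ((↑) : ℚ → ℝ)) :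
    r ∈ Set.range ((↑) : ℚ → ℝ) := by
  obtain ⟨a, ha⟩ := Function.ne_iff.mp hpq
  obtain ⟨x, hx⟩ := hp a
  obtain ⟨y, hy⟩ := hq a
  obtain ⟨z, hz⟩ := h a
  have hne : q a - p a ≠ 0 := sub_ne_zero.mpr (Ne.symm ha)
  refine ⟨(z - x) / (y - x), ?_⟩
  push_cast
  rw [hx, hy, hz, div_eq_iff hne]
  simp only [Pi.add_apply, Pi.smul_apply, smul_eq_mul]
  ring

theorem mVert_rat (i : ZMod 3) (a : Fin 2) : mVert i a ∈ Set.range ((↑) : ℚ → ℝ) := by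
  rcases zmod_three_cases i with rfl | rfl | rfl <;> fin_cases a
  exacts [⟨-1, by simp [mVert_zero]⟩,
    ⟨-1, by simp [mVert_zero]⟩,
    ⟨-1, by simp [mVert_one]⟩,
    ⟨2, by simp [mVert_one]⟩,
    ⟨2, by simp [mVert_two]⟩,
    ⟨-1, by simp [mVert_two]⟩]

theorem nVert_rat (i : ZMod 3) (a : Fin 2) : nVert i a ∈ Set.range ((↑) : ℚ → ℝ) := by
  rcases zmod_three_cases i with rfl | rfl | rfl <;> fin_cases a
  exacts [⟨-1, by simp [nVert_zero]⟩,
    ⟨0, by simp [nVert_zero]⟩,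
    ⟨1, by simp [nVert_one]⟩,
    ⟨1, by simp [nVert_one]⟩,
    ⟨0, by simp [nVert_two]⟩,
    ⟨-1, by simp [nVert_two]⟩]

theorem mVert_ne_succ (i : ZMod 3) : mVert i ≠ mVert (i + 1) := by
  intro h
  have h1 := mVert_dotProduct_nVert (i + 1)
  have h2 := mVert_dotProduct_nVert_succ i
  rw [h, h1] at h2
  norm_num at h2

theorem nVert_ne_succ (i : ZMod 3) : nVert i ≠ nVert (i + 1) := by
  intro h
  have h1 := mVert_dotProduct_nVert i
  have h2 := mVert_dotProduct_nVert_succ i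
  rw [← h, h1] at h2
  norm_num at h2

theorem polyline_eq_edge (v : ZMod 3 → (Fin 2 → ℝ)) (t : ℝ) :
    polyline v t =
      (1 - Int.fract t) • v ((⌊t⌋ : ℤ) : ZMod 3) + Int.fract t • v (((⌊t⌋ : ℤ) : ZMod 3) + 1) := by
  simp only [polyline, Int.fract]
  push_cast
  congr 2
  ring

theorem rat_of_coverMdual_mem_bdryLattice {l : ℚ} {tv : ℝ} (h : coverMdual tv ∈ bdryLattice l) :
    tv ∈ Set.range ((↑) : ℚ → ℝ) := by
  obtain ⟨-, z, hz⟩ := h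
  have hfr : Int.fract (tv / 3) ∈ Set.range ((↑) : ℚ → ℝ) := by
    refine mem_range_ratCast_of_edge (mVert_rat _) (mVert_rat _) (mVert_ne_succ ⌊tv / 3⌋) ?_
    rw [← polyline_eq_edge]
    intro a
    change coverMdual tv a ∈ _
    obtain ⟨x, hx⟩ := mVert_rat 0 a
    exact ⟨x + l⁻¹ * z a, by rw [hz]; simp [hx]⟩
  obtain ⟨q, hq⟩ := hfr
  refine ⟨3 * (⌊tv / 3⌋ + q), ?_⟩
  push_cast
  rw [hq, Int.floor_add_fract]
  ring

theorem irrational_of_coverM_eq {j : ZMod 3} {r t : ℝ} (hr : Irrational r)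
    (h : coverM t = edgePoint j r) : Irrational t := by
  rintro ⟨q, rfl⟩
  refine hr (mem_range_ratCast_of_edge (nVert_rat j) (nVert_rat (j + 1)) (nVert_ne_succ j) ?_)
  intro a
  change edgePoint j r a ∈ _
  rw [← h]
  obtain ⟨x, hx⟩ := nVert_rat ((⌊(q : ℝ)⌋ : ℤ) : ZMod 3) a
  obtain ⟨y, hy⟩ := nVert_rat ((⌊(q : ℝ)⌋ + 1 : ℤ) : ZMod 3) a
  refine ⟨(⌊(q : ℝ)⌋ + 1 - q) * x + (q - ⌊(q : ℝ)⌋) * y, ?_⟩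
  simp only [coverM, polyline, Pi.add_apply, Pi.smul_apply, smul_eq_mul, ← hx, ← hy]
  push_cast
  rfl

/-- Over a point of an edge with irrational parameter, the costs of two distinct lattice points
differ by an irrational number. -/
theorem irrational_cost_sub_cost {l : ℚ} {m m' : Fin 2 → ℝ} (hm : m ∈ bdryLattice l)
    (hm' : m' ∈ bdryLattice l) (hne : m ≠ m') (j : ZMod 3) {r : ℝ} (hr : r ∈ Set.Icc (0 : ℝ) 1)
    (hirr : Irrational r) :
    Irrational (cost m (edgePoint j r) - cost m' (edgePoint j r)) := by
  have ht := irrational_of_coverM_eq hirr (coverM_invFun_edgePoint j hr)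
  have hm1 := coverMdual_invFun hm.1
  have hm1' := coverMdual_invFun hm'.1
  unfold cost costLift
  generalize Function.invFun coverM (edgePoint j r) = t at *
  generalize Function.invFun coverMdual m = u at *
  generalize Function.invFun coverMdual m' = u' at *
  obtain ⟨q, hq⟩ := rat_of_coverMdual_mem_bdryLattice (hm1.symm ▸ hm)
  obtain ⟨q', hq'⟩ := rat_of_coverMdual_mem_bdryLattice (hm1'.symm ▸ hm')
  obtain ⟨x, hx⟩ := exists_rat_Phi0Star ⟨q, hq⟩
  obtain ⟨x', hx'⟩ := exists_rat_Phi0Star ⟨q', hq'⟩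
  obtain ⟨h, hp, -⟩ := exists_pairing_eq t u
  obtain ⟨h', hp', -⟩ := exists_pairing_eq t u'
  -- Equal slopes would make the two lifts congruent modulo the period `9`, hence `m = m'`.
  have hS : (q' - 9 * h') - (q - 9 * h) ≠ 0 := by
    intro h0
    apply hne
    have hqq : u = u' + 9 * ((h - h' : ℤ) : ℝ) := by
      have : q = q' + 9 * ((h - h' : ℤ) : ℚ) := by push_cast; linarith
      rw [← hq, ← hq', this]
      push_cast
      ring
    rw [← hm1, ← hm1', hqq, coverMdual, coverMdual,
      show (u' + 9 * ((h - h' : ℤ) : ℝ)) / 3 = u' / 3 + 3 * ((h - h' : ℤ) : ℝ) by ring,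
      polyline_add_three]
  have key := (ht.ratCast_mul hS).ratCast_add
    (3 * h' * q' - 27 * h' ^ 2 / 2 - 9 * h' / 2 - (3 * h * q - 27 * h ^ 2 / 2 - 9 * h / 2) + x - x')
  convert key using 1
  rw [hp, hp', ← hx, ← hx', ← hq, ← hq']
  push_cast
  ring

/-! ### The monomial valuation on `ℂ[[x, y]]`. -/

/-- The weight `(1-r) p + r q` of the monomial `x^p y^q`. -/
noncomputable def weight (r : ℝ) : (Fin 2 →₀ ℕ) →+ ℝ where
  toFun d := (1 - r) * d 0 + r * d 1
  map_zero' := by simp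
  map_add' d e := by simp only [Finsupp.coe_add, Pi.add_apply]; push_cast; ring

theorem weight_apply (r : ℝ) (d : Fin 2 →₀ ℕ) : weight r d = (1 - r) * d 0 + r * d 1 := rfl

theorem monomialVal_eq (r : ℝ) (f : MvPowerSeries (Fin 2) ℂ) :
    monomialVal r f =
      ⨅ (d : Fin 2 →₀ ℕ) (_ : MvPowerSeries.coeff d f ≠ 0), ((weight r d : ℝ) : EReal) :=
  rfl

theorem weight_mono {r : ℝ} (hr : r ∈ Set.Icc (0 : ℝ) 1) {d e : Fin 2 →₀ ℕ} (h : d ≤ e) :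
    weight r d ≤ weight r e := by
  have h0 : (d 0 : ℝ) ≤ e 0 := by exact_mod_cast h 0
  have h1 : (d 1 : ℝ) ≤ e 1 := by exact_mod_cast h 1
  exact add_le_add (mul_le_mul_of_nonneg_left h0 (by linarith [hr.2]))
    (mul_le_mul_of_nonneg_left h1 hr.1)

theorem weight_injective {r : ℝ} (hr : Irrational r) : Function.Injective (weight r) := by
  intro d e h
  simp only [weight_apply] at h
  have key : r * (((d 1 : ℤ) - d 0 - (e 1 - e 0) : ℤ) : ℝ) = ((e 0 - d 0 : ℤ) : ℝ) := by
    push_cast; linarith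
  have h1 : (d 1 : ℤ) - d 0 - (e 1 - e 0) = 0 := by
    by_contra hne
    exact (hr.mul_intCast hne).ne_int _ key
  have h0 : (e 0 - d 0 : ℤ) = 0 := by
    rw [h1, Int.cast_zero, mul_zero] at key
    exact_mod_cast key.symm
  ext i
  fin_cases i
  · change d 0 = e 0; omega
  · change d 1 = e 1; omega

/-- A set of exponents is dominated by finitely many of its elements (Dickson's lemma). -/
theorem exists_finset_minimals (S : Set (Fin 2 →₀ ℕ)) :
    ∃ F : Finset (Fin 2 →₀ ℕ), (∀ d ∈ F, d ∈ S) ∧ ∀ e ∈ S, ∃ d ∈ F, d ≤ e := by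
  have hfin : {d | Minimal (· ∈ S) d}.Finite :=
    WellQuasiOrderedLE.finite_of_isAntichain (setOfPred_minimal_antichain _)
  refine ⟨hfin.toFinset, fun d hd => ?_, fun e he => ?_⟩
  · exact ((Set.Finite.mem_toFinset _).mp hd).prop
  · obtain ⟨d, hde, hd⟩ := exists_minimal_le_of_wellFoundedLT (· ∈ S) e he
    exact ⟨d, (Set.Finite.mem_toFinset _).mpr hd, hde⟩

/-- The point is that `F` does not depend on `r`: the valuation is a minimum of finitely many affine
functions of `r`, hence continuous. Minimal exponents suffice because weights are monotone. -/
theorem exists_monomialVal_eq_inf' {f : MvPowerSeries (Fin 2) ℂ} (hf : f ≠ 0) :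
    ∃ (F : Finset (Fin 2 →₀ ℕ)) (hF : F.Nonempty), (∀ d ∈ F, MvPowerSeries.coeff d f ≠ 0) ∧
      ∀ r ∈ Set.Icc (0 : ℝ) 1, monomialVal r f = ((F.inf' hF (weight r) : ℝ) : EReal) ∧
        ∀ e, MvPowerSeries.coeff e f ≠ 0 → F.inf' hF (weight r) ≤ weight r e := by
  obtain ⟨F, hFS, hF⟩ := exists_finset_minimals {d | MvPowerSeries.coeff d f ≠ 0}
  obtain ⟨e, he⟩ : ∃ e, MvPowerSeries.coeff e f ≠ 0 := by
    by_contra! h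
    exact hf (MvPowerSeries.ext fun n => by simpa using h n)
  have hne : F.Nonempty := let ⟨d, hd, _⟩ := hF e he; ⟨d, hd⟩
  refine ⟨F, hne, hFS, fun r hr => ?_⟩
  have hle : ∀ e, MvPowerSeries.coeff e f ≠ 0 → F.inf' hne (weight r) ≤ weight r e := by
    intro e he
    obtain ⟨d, hd, hde⟩ := hF e he
    exact (Finset.inf'_le _ hd).trans (weight_mono hr hde)
  refine ⟨le_antisymm ?_ ?_, hle⟩
  · obtain ⟨d, hd, hdeq⟩ := Finset.exists_mem_eq_inf' hne (weight r)
    rw [hdeq, monomialVal_eq]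
    exact iInf₂_le d (hFS d hd)
  · rw [monomialVal_eq]
    exact le_iInf₂ fun e he => EReal.coe_le_coe_iff.mpr (hle e he)

theorem monomialVal_zero (r : ℝ) : monomialVal r 0 = ⊤ := by
  simp [monomialVal_eq]

/-- The real number `monomialVal r f` for `f ≠ 0`. -/
noncomputable def monomialOrd (r : ℝ) (f : MvPowerSeries (Fin 2) ℂ) : ℝ := (monomialVal r f).toReal

theorem coe_monomialOrd {r : ℝ} (hr : r ∈ Set.Icc (0 : ℝ) 1) {f : MvPowerSeries (Fin 2) ℂ}
    (hf : f ≠ 0) : ((monomialOrd r f : ℝ) : EReal) = monomialVal r f := by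
  obtain ⟨F, hF, -, h⟩ := exists_monomialVal_eq_inf' hf
  rw [monomialOrd, (h r hr).1, EReal.toReal_coe]

theorem continuousOn_monomialOrd {f : MvPowerSeries (Fin 2) ℂ} (hf : f ≠ 0) :
    ContinuousOn (fun r => monomialOrd r f) (Set.Icc 0 1) := by
  obtain ⟨F, hF, -, h⟩ := exists_monomialVal_eq_inf' hf
  have hc : ContinuousOn (fun r => F.inf' hF (weight r)) (Set.Icc 0 1) := by
    refine ContinuousOn.finset_inf'_apply hF fun d _ => ?_
    simp only [weight_apply]
    fun_prop
  refine hc.congr fun r hr => ?_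
  simp only [monomialOrd, (h r hr).1, EReal.toReal_coe]

/-- The order is attained by some monomial of `f`, and is a lower bound for all of them. -/
theorem exists_weight_eq_monomialOrd {r : ℝ} (hr : r ∈ Set.Icc (0 : ℝ) 1)
    {f : MvPowerSeries (Fin 2) ℂ} (hf : f ≠ 0) :
    ∃ d, MvPowerSeries.coeff d f ≠ 0 ∧ weight r d = monomialOrd r f := by
  obtain ⟨F, hF, hS, h⟩ := exists_monomialVal_eq_inf' hf
  obtain ⟨d, hd, hdeq⟩ := Finset.exists_mem_eq_inf' hF (weight r)
  exact ⟨d, hS d hd, by rw [monomialOrd, (h r hr).1, EReal.toReal_coe, hdeq]⟩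

theorem monomialOrd_le {r : ℝ} (hr : r ∈ Set.Icc (0 : ℝ) 1)
    {f : MvPowerSeries (Fin 2) ℂ} {e : Fin 2 →₀ ℕ} (he : MvPowerSeries.coeff e f ≠ 0) :
    monomialOrd r f ≤ weight r e := by
  have hf : f ≠ 0 := by rintro rfl; simp at he
  obtain ⟨F, hF, hS, h⟩ := exists_monomialVal_eq_inf' hf
  rw [monomialOrd, (h r hr).1, EReal.toReal_coe]
  exact (h r hr).2 e he

/-- For irrational `r` each factor has a single monomial of least weight, so the product of these
two monomials cannot be cancelled. -/
theorem monomialOrd_mul {r : ℝ} (hr : r ∈ Set.Icc (0 : ℝ) 1) (hirr : Irrational r)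
    {f g : MvPowerSeries (Fin 2) ℂ} (hf : f ≠ 0) (hg : g ≠ 0) :
    monomialOrd r (f * g) = monomialOrd r f + monomialOrd r g := by
  classical
  obtain ⟨d, hd, hdf⟩ := exists_weight_eq_monomialOrd hr hf
  obtain ⟨e, he, heg⟩ := exists_weight_eq_monomialOrd hr hg
  have hcoeff : MvPowerSeries.coeff (d + e) (f * g) =
      MvPowerSeries.coeff d f * MvPowerSeries.coeff e g := by
    rw [MvPowerSeries.coeff_mul]
    refine Finset.sum_eq_single (d, e) (fun p hp hne => ?_) (fun h => absurd (by simp) h)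
    by_contra h0
    have h1 := monomialOrd_le hr (left_ne_zero_of_mul h0)
    have h2 := monomialOrd_le hr (right_ne_zero_of_mul h0)
    have h3 := congrArg (weight r) (Finset.HasAntidiagonal.mem_antidiagonal.mp hp)
    simp only [map_add] at h3
    exact hne (Prod.ext (weight_injective hirr (by linarith)) (weight_injective hirr (by linarith)))
  apply le_antisymm
  · rw [← hdf, ← heg, ← map_add]
    exact monomialOrd_le hr (hcoeff ▸ mul_ne_zero hd he)
  · obtain ⟨c, hc, hcfg⟩ := exists_weight_eq_monomialOrd hr (mul_ne_zero hf hg)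
    rw [← hcfg]
    rw [MvPowerSeries.coeff_mul] at hc
    obtain ⟨p, hp, h0⟩ := Finset.exists_ne_zero_of_sum_ne_zero hc
    rw [← Finset.HasAntidiagonal.mem_antidiagonal.mp hp, map_add]
    exact add_le_add (monomialOrd_le hr (left_ne_zero_of_mul h0))
      (monomialOrd_le hr (right_ne_zero_of_mul h0))

theorem min_le_monomialOrd_add {r : ℝ} (hr : r ∈ Set.Icc (0 : ℝ) 1)
    {f g : MvPowerSeries (Fin 2) ℂ} (hfg : f + g ≠ 0) :
    min (monomialOrd r f) (monomialOrd r g) ≤ monomialOrd r (f + g) := by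
  obtain ⟨c, hc, hcfg⟩ := exists_weight_eq_monomialOrd hr hfg
  rw [← hcfg]
  by_cases h : MvPowerSeries.coeff c f = 0
  · refine min_le_of_right_le (monomialOrd_le hr ?_)
    rwa [map_add, h, zero_add] at hc
  · exact min_le_of_left_le (monomialOrd_le hr h)

theorem monomialOrd_of_constantCoeff_ne_zero {r : ℝ} (hr : r ∈ Set.Icc (0 : ℝ) 1)
    {f : MvPowerSeries (Fin 2) ℂ} (hf : MvPowerSeries.constantCoeff f ≠ 0) :
    monomialOrd r f = 0 := by
  rw [← MvPowerSeries.coeff_zero_eq_constantCoeff_apply] at hf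
  have hf0 : f ≠ 0 := by rintro rfl; simp at hf
  apply le_antisymm
  · simpa using monomialOrd_le hr hf
  · obtain ⟨c, -, hc⟩ := exists_weight_eq_monomialOrd hr hf0
    rw [← hc]
    simpa using weight_mono hr (zero_le (a := c))

/-! The extension to fractions. -/

/-- The real number `localVal r z` for `z ≠ 0`. -/
noncomputable def localOrd (r : ℝ) (z : LocalField) : ℝ :=
  monomialOrd r (IsLocalization.sec (nonZeroDivisors (MvPowerSeries (Fin 2) ℂ)) z).1
    - monomialOrd r (IsLocalization.sec (nonZeroDivisors (MvPowerSeries (Fin 2) ℂ)) z).2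

theorem sec_fst_ne_zero {z : LocalField} (hz : z ≠ 0) :
    (IsLocalization.sec (nonZeroDivisors (MvPowerSeries (Fin 2) ℂ)) z).1 ≠ 0 := by
  intro h
  have := IsLocalization.sec_spec (nonZeroDivisors (MvPowerSeries (Fin 2) ℂ)) z
  rw [h, map_zero] at this
  rcases mul_eq_zero.mp this with h | h
  · exact hz h
  · exact IsLocalization.to_map_ne_zero_of_mem_nonZeroDivisors _ le_rfl (SetLike.coe_mem _) h

theorem sec_snd_ne_zero (z : LocalField) :
    ((IsLocalization.sec (nonZeroDivisors (MvPowerSeries (Fin 2) ℂ)) z).2 :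
      MvPowerSeries (Fin 2) ℂ) ≠ 0 :=
  nonZeroDivisors.coe_ne_zero _

theorem coe_localOrd {r : ℝ} (hr : r ∈ Set.Icc (0 : ℝ) 1) {z : LocalField} (hz : z ≠ 0) :
    ((localOrd r z : ℝ) : EReal) = localVal r z := by
  rw [localOrd, localVal, EReal.coe_sub, coe_monomialOrd hr (sec_fst_ne_zero hz),
    coe_monomialOrd hr (sec_snd_ne_zero z)]

theorem localVal_zero {r : ℝ} (hr : r ∈ Set.Icc (0 : ℝ) 1) : localVal r 0 = ⊤ := by
  have h : (IsLocalization.sec (nonZeroDivisors (MvPowerSeries (Fin 2) ℂ)) (0 : LocalField)).1 = 0 := by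
    have := IsLocalization.sec_spec (nonZeroDivisors (MvPowerSeries (Fin 2) ℂ)) (0 : LocalField)
    rw [zero_mul] at this
    exact IsFractionRing.injective (MvPowerSeries (Fin 2) ℂ) LocalField (this.symm.trans (map_zero _).symm)
  rw [localVal, h, monomialVal_zero, ← coe_monomialOrd hr (sec_snd_ne_zero 0), EReal.top_sub_coe]

/-- The fraction chosen by `IsLocalization.sec` does not depend on `r`, so continuity requires no
independence of representatives. -/
theorem continuousOn_localOrd {z : LocalField} (hz : z ≠ 0) :
    ContinuousOn (fun r => localOrd r z) (Set.Icc 0 1) :=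
  (continuousOn_monomialOrd (sec_fst_ne_zero hz)).sub (continuousOn_monomialOrd (sec_snd_ne_zero z))

theorem continuousOn_localVal (z : LocalField) :
    ContinuousOn (fun r => localVal r z) (Set.Icc 0 1) := by
  rcases eq_or_ne z 0 with rfl | hz
  · exact continuousOn_const.congr fun r hr => localVal_zero hr
  · exact (continuous_coe_real_ereal.comp_continuousOn (continuousOn_localOrd hz)).congr
      fun r hr => (coe_localOrd hr hz).symm

theorem localOrd_eq_of_mul_eq {r : ℝ} (hr : r ∈ Set.Icc (0 : ℝ) 1) (hirr : Irrational r)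
    {z : LocalField} {f g : MvPowerSeries (Fin 2) ℂ} (hf : f ≠ 0)
    (hg : g ≠ 0) (h : z * algebraMap _ LocalField g = algebraMap _ LocalField f) :
    localOrd r z = monomialOrd r f - monomialOrd r g := by
  have hz : z ≠ 0 := by
    rintro rfl
    rw [zero_mul] at h
    exact hf (IsFractionRing.injective (MvPowerSeries (Fin 2) ℂ) LocalField (by rw [map_zero, h]))
  have h2 := IsLocalization.sec_spec (nonZeroDivisors (MvPowerSeries (Fin 2) ℂ)) z
  have h1 := sec_fst_ne_zero hz
  have h3 := sec_snd_ne_zero z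
  rw [localOrd]
  generalize IsLocalization.sec (nonZeroDivisors (MvPowerSeries (Fin 2) ℂ)) z = p at *
  have key : f * p.2 = p.1 * g := by
    apply IsFractionRing.injective (MvPowerSeries (Fin 2) ℂ) LocalField
    rw [map_mul, map_mul, ← h, ← h2]
    ring
  have := congrArg (monomialOrd r) key
  rw [monomialOrd_mul hr hirr hf h3, monomialOrd_mul hr hirr h1 hg] at this
  linarith

theorem localOrd_algebraMap {r : ℝ} (hr : r ∈ Set.Icc (0 : ℝ) 1) (hirr : Irrational r)
    {f : MvPowerSeries (Fin 2) ℂ} (hf : f ≠ 0) :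
    localOrd r (algebraMap _ LocalField f) = monomialOrd r f := by
  rw [localOrd_eq_of_mul_eq hr hirr hf one_ne_zero (by rw [map_one, mul_one]),
    monomialOrd_of_constantCoeff_ne_zero (f := 1) hr (by simp), sub_zero]

theorem localOrd_mul {r : ℝ} (hr : r ∈ Set.Icc (0 : ℝ) 1) (hirr : Irrational r)
    {z w : LocalField} (hz : z ≠ 0) (hw : w ≠ 0) :
    localOrd r (z * w) = localOrd r z + localOrd r w := by
  have h1 := IsLocalization.sec_spec (nonZeroDivisors (MvPowerSeries (Fin 2) ℂ)) z
  have h2 := IsLocalization.sec_spec (nonZeroDivisors (MvPowerSeries (Fin 2) ℂ)) w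
  rw [localOrd_eq_of_mul_eq hr hirr (mul_ne_zero (sec_fst_ne_zero hz) (sec_fst_ne_zero hw))
    (mul_ne_zero (sec_snd_ne_zero z) (sec_snd_ne_zero w)) (z := z * w)
    (by rw [map_mul, map_mul, ← h1, ← h2]; ring),
    monomialOrd_mul hr hirr (sec_fst_ne_zero hz) (sec_fst_ne_zero hw),
    monomialOrd_mul hr hirr (sec_snd_ne_zero z) (sec_snd_ne_zero w), localOrd, localOrd]
  ring

theorem min_le_localOrd_add {r : ℝ} (hr : r ∈ Set.Icc (0 : ℝ) 1) (hirr : Irrational r)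
    {z w : LocalField} (hz : z ≠ 0) (hw : w ≠ 0) (hzw : z + w ≠ 0) :
    min (localOrd r z) (localOrd r w) ≤ localOrd r (z + w) := by
  have h1 := IsLocalization.sec_spec (nonZeroDivisors (MvPowerSeries (Fin 2) ℂ)) z
  have h2 := IsLocalization.sec_spec (nonZeroDivisors (MvPowerSeries (Fin 2) ℂ)) w
  have n1 := sec_fst_ne_zero hz
  have n2 := sec_fst_ne_zero hw
  have d1 := sec_snd_ne_zero z
  have d2 := sec_snd_ne_zero w
  unfold localOrd at *
  -- The term for `z + w` is folded back, so that only the fractions of `z` and `w` are opened.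
  rw [← localOrd.eq_1 r (z + w)]
  generalize IsLocalization.sec (nonZeroDivisors (MvPowerSeries (Fin 2) ℂ)) z = p at *
  generalize IsLocalization.sec (nonZeroDivisors (MvPowerSeries (Fin 2) ℂ)) w = q at *
  have hspec : (z + w) * algebraMap _ LocalField ((p.2 : MvPowerSeries (Fin 2) ℂ) * q.2) =
      algebraMap _ LocalField (p.1 * q.2 + q.1 * p.2) := by
    rw [map_add, map_mul, map_mul, map_mul, ← h1, ← h2]; ring
  have hnum : p.1 * q.2 + q.1 * p.2 ≠ 0 := by
    intro h
    rw [h, map_zero] at hspec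
    rcases mul_eq_zero.mp hspec with h | h
    · exact hzw h
    · exact mul_ne_zero d1 d2
        (IsFractionRing.injective (MvPowerSeries (Fin 2) ℂ) LocalField (by rw [map_zero, h]))
  rw [localOrd_eq_of_mul_eq hr hirr hnum (mul_ne_zero d1 d2) hspec]
  have := min_le_monomialOrd_add hr hnum
  rw [monomialOrd_mul hr hirr n1 d2, monomialOrd_mul hr hirr n2 d1] at this
  rw [monomialOrd_mul hr hirr d1 d2]
  rw [min_le_iff] at this ⊢
  rcases this with h | h
  · left; linarith
  · right; linarith

open Classical in
/-- For irrational `r` the monomial valuation, as an additive valuation. -/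
noncomputable def localAddValuation {r : ℝ} (hr : r ∈ Set.Icc (0 : ℝ) 1) (hirr : Irrational r) :
    AddValuation LocalField (WithTop ℝ) :=
  AddValuation.of (fun z => if z = 0 then ⊤ else ((localOrd r z : ℝ) : WithTop ℝ)) (by simp)
    (by
      rw [if_neg one_ne_zero, ← map_one (algebraMap (MvPowerSeries (Fin 2) ℂ) LocalField),
        localOrd_algebraMap hr hirr one_ne_zero,
        monomialOrd_of_constantCoeff_ne_zero (f := 1) hr (by simp)]
      rfl)
    (by
      intro z w
      by_cases hz : z = 0
      · simp [hz]
      by_cases hw : w = 0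
      · simp [hw]
      by_cases hzw : z + w = 0
      · simp [hzw]
      rw [if_neg hz, if_neg hw, if_neg hzw, ← WithTop.coe_min, WithTop.coe_le_coe]
      exact min_le_localOrd_add hr hirr hz hw hzw)
    (by
      intro z w
      by_cases hz : z = 0
      · simp [hz]
      by_cases hw : w = 0
      · simp [hw]
      rw [if_neg hz, if_neg hw, if_neg (mul_ne_zero hz hw), localOrd_mul hr hirr hz hw]
      rfl)

theorem localAddValuation_apply {r : ℝ} (hr : r ∈ Set.Icc (0 : ℝ) 1) (hirr : Irrational r)
    {z : LocalField} (hz : z ≠ 0) :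
    localAddValuation hr hirr z = ((localOrd r z : ℝ) : WithTop ℝ) :=
  if_neg hz

/-- The valuation of a nonempty sum of terms of distinct valuations. -/
theorem exists_localOrd_sum_eq {r : ℝ} (hr : r ∈ Set.Icc (0 : ℝ) 1) (hirr : Irrational r)
    {ι : Type*} {s : Finset ι} (hs : s.Nonempty) {z : ι → LocalField}
    (hz : ∀ i ∈ s, z i ≠ 0)
    (hinj : ∀ i ∈ s, ∀ j ∈ s, i ≠ j → localOrd r (z i) ≠ localOrd r (z j)) :
    ∑ i ∈ s, z i ≠ 0 ∧ localOrd r (∑ i ∈ s, z i) = s.inf' hs fun i => localOrd r (z i) := by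
  classical
  obtain ⟨i, hi, hmin⟩ := Finset.exists_mem_eq_inf' hs fun i => localOrd r (z i)
  set v := localAddValuation hr hirr
  -- The term of least valuation is strictly below all others, hence below their sum.
  have hlt : v (z i) < v (∑ j ∈ s.erase i, z j) := by
    rw [localAddValuation_apply hr hirr (hz i hi)]
    refine v.map_lt_sum' (WithTop.coe_lt_top _) fun j hj => ?_
    obtain ⟨hji, hj⟩ := Finset.mem_erase.mp hj
    rw [localAddValuation_apply hr hirr (hz j hj), WithTop.coe_lt_coe]
    refine lt_of_le_of_ne ?_ (hinj i hi j hj hji.symm)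
    rw [← hmin]
    exact Finset.inf'_le (fun i => localOrd r (z i)) hj
  have hsum : v (∑ j ∈ s, z j) = v (z i) := by
    rw [← Finset.add_sum_erase s z hi]
    exact v.map_add_eq_of_lt_left hlt
  rw [localAddValuation_apply hr hirr (hz i hi)] at hsum
  have hne : ∑ j ∈ s, z j ≠ 0 := by
    intro h
    rw [h, v.map_zero] at hsum
    exact WithTop.coe_ne_top hsum.symm
  refine ⟨hne, ?_⟩
  rw [localAddValuation_apply hr hirr hne] at hsum
  rw [hmin]
  exact WithTop.coe_injective hsum

/-! ### Restriction of the monomial valuation to `K`. -/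

theorem KToLocal_ofPowerSeries (f : PowerSeries ℂ) :
    KToLocal (KEquiv.symm (HahnSeries.ofPowerSeries ℤ ℂ f)) = powerSeriesToLocal f := by
  change IsLocalization.Away.lift (S := LaurentSeries ℂ) (PowerSeries.X : PowerSeries ℂ)
    isUnit_powerSeriesToLocal_X (KEquiv (KEquiv.symm (HahnSeries.ofPowerSeries ℤ ℂ f))) = _
  rw [RingEquiv.apply_symm_apply, ← LaurentSeries.coe_algebraMap]
  exact IsLocalization.Away.lift_eq _ _ _

theorem powerSeriesToLocal_apply (f : PowerSeries ℂ) : powerSeriesToLocal f =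
    algebraMap (MvPowerSeries (Fin 2) ℂ) LocalField (PowerSeries.substAlgHom hasSubst_tSeries f) :=
  rfl

theorem KToLocal_tK : KToLocal tK = algebraMap (MvPowerSeries (Fin 2) ℂ) LocalField tSeries := by
  rw [tK, ← HahnSeries.ofPowerSeries_X, KToLocal_ofPowerSeries, powerSeriesToLocal_apply,
    PowerSeries.substAlgHom_X]

theorem tK_ne_zero : tK ≠ 0 := by
  rw [tK, ne_eq, EmbeddingLike.map_eq_zero_iff]
  exact HahnSeries.single_ne_zero one_ne_zero

theorem tSeries_mul : tSeries *
    (1 + MvPowerSeries.X 0 ^ 3 + MvPowerSeries.X 1 ^ 3) = MvPowerSeries.X 0 * MvPowerSeries.X 1 := by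
  rw [tSeries, mul_assoc, MvPowerSeries.inv_mul_cancel _ (by simp), mul_one]

theorem monomialOrd_X {r : ℝ} (hr : r ∈ Set.Icc (0 : ℝ) 1) (i : Fin 2) :
    monomialOrd r (MvPowerSeries.X i : MvPowerSeries (Fin 2) ℂ) = weight r (Finsupp.single i 1) := by
  classical
  have hc : MvPowerSeries.coeff (Finsupp.single i 1) (MvPowerSeries.X i : MvPowerSeries (Fin 2) ℂ)
      ≠ 0 := by simp [MvPowerSeries.coeff_X]
  have h0 : (MvPowerSeries.X i : MvPowerSeries (Fin 2) ℂ) ≠ 0 := by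
    intro h
    rw [h] at hc
    simp at hc
  obtain ⟨d, hd, hd'⟩ := exists_weight_eq_monomialOrd hr h0
  rw [MvPowerSeries.coeff_X] at hd
  rw [← hd', (ite_ne_right_iff.mp hd).1]

/-- Up to a unit `t` is `xy`, of weight `(1 - r) + r = 1`. -/
theorem monomialOrd_tSeries {r : ℝ} (hr : r ∈ Set.Icc (0 : ℝ) 1) (hirr : Irrational r) :
    monomialOrd r tSeries = 1 := by
  have h0 : (MvPowerSeries.constantCoeff
      (1 + MvPowerSeries.X 0 ^ 3 + MvPowerSeries.X 1 ^ 3 : MvPowerSeries (Fin 2) ℂ)) ≠ 0 := by simp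
  have hne : (1 + MvPowerSeries.X 0 ^ 3 + MvPowerSeries.X 1 ^ 3 : MvPowerSeries (Fin 2) ℂ) ≠ 0 := by
    intro h
    rw [h] at h0
    simp at h0
  have hX : (MvPowerSeries.X 0 * MvPowerSeries.X 1 : MvPowerSeries (Fin 2) ℂ) ≠ 0 := by
    rw [← tSeries_mul]
    exact mul_ne_zero tSeries_ne_zero hne
  have h := congrArg (monomialOrd r) tSeries_mul
  rw [monomialOrd_mul hr hirr tSeries_ne_zero hne, monomialOrd_of_constantCoeff_ne_zero hr h0,
    monomialOrd_mul hr hirr (left_ne_zero_of_mul hX) (right_ne_zero_of_mul hX), monomialOrd_X hr,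
    monomialOrd_X hr] at h
  simpa [weight_apply] using h

theorem localOrd_zpow {r : ℝ} (hr : r ∈ Set.Icc (0 : ℝ) 1) (hirr : Irrational r) {z : LocalField}
    (hz : z ≠ 0) (n : ℤ) : localOrd r (z ^ n) = n * localOrd r z := by
  have hone : localOrd r (1 : LocalField) = 0 := by
    have := localOrd_mul hr hirr (one_ne_zero (α := LocalField)) one_ne_zero
    rw [mul_one] at this
    linarith
  induction n using Int.induction_on with
  | zero => simp [hone]
  | succ n ih =>
    rw [zpow_add_one₀ hz, localOrd_mul hr hirr (zpow_ne_zero _ hz) hz, ih]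
    push_cast
    ring
  | pred n ih =>
    have h := localOrd_mul hr hirr (zpow_ne_zero (-(n : ℤ) - 1) hz) hz
    rw [← zpow_add_one₀ hz, sub_add_cancel, ih] at h
    push_cast at h ⊢
    linarith

/-- A nonzero Laurent series is a power of `t` times a unit of `ℂ[[t]]`, and the unit stays a unit,
of order `0`, in `ℂ[[x, y]]`. -/
theorem localOrd_KToLocal {r : ℝ} (hr : r ∈ Set.Icc (0 : ℝ) 1) (hirr : Irrational r) {a : K}
    (ha : a ≠ 0) : localOrd r (KToLocal a) = valT a := by
  set f := KEquiv a with hf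
  have hf0 : f ≠ 0 := by rwa [hf, ne_eq, EmbeddingLike.map_eq_zero_iff]
  have hu : IsUnit f.powerSeriesPart := by
    rw [PowerSeries.isUnit_iff_constantCoeff, isUnit_iff_ne_zero,
      ← PowerSeries.coeff_zero_eq_constantCoeff_apply, LaurentSeries.powerSeriesPart_coeff]
    simpa using hf0
  have hdecomp : a = tK ^ f.order *
      KEquiv.symm (HahnSeries.ofPowerSeries ℤ ℂ f.powerSeriesPart) := by
    apply KEquiv.injective
    rw [map_mul, map_zpow₀, tK, RingEquiv.apply_symm_apply, RingEquiv.apply_symm_apply, ← hf]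
    conv_lhs => rw [← LaurentSeries.single_order_mul_powerSeriesPart f]
    rw [RatFunc.single_zpow]
  have hsu : IsUnit (PowerSeries.substAlgHom (R := ℂ) hasSubst_tSeries f.powerSeriesPart) :=
    hu.map _
  have hsu0 : algebraMap (MvPowerSeries (Fin 2) ℂ) LocalField
      (PowerSeries.substAlgHom (R := ℂ) hasSubst_tSeries f.powerSeriesPart) ≠ 0 :=
    (hsu.map _).ne_zero
  have ht : algebraMap (MvPowerSeries (Fin 2) ℂ) LocalField tSeries ≠ 0 := by
    rw [← KToLocal_tK]
    exact (map_ne_zero _).mpr tK_ne_zero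
  conv_lhs => rw [hdecomp]
  rw [map_mul, map_zpow₀, KToLocal_ofPowerSeries, powerSeriesToLocal_apply, KToLocal_tK,
    localOrd_mul hr hirr (zpow_ne_zero _ ht) hsu0, localOrd_zpow hr hirr ht,
    localOrd_algebraMap hr hirr tSeries_ne_zero, localOrd_algebraMap hr hirr hsu.ne_zero,
    monomialOrd_tSeries hr hirr,
    monomialOrd_of_constantCoeff_ne_zero hr (hsu.map MvPowerSeries.constantCoeff).ne_zero,
    mul_one, add_zero, valT]

/-! The expansion of a section. -/

theorem expandPoly_X (j i : ZMod 3) : expandPoly j (MvPolynomial.X i) =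
    if i = j then algebraMap (MvPowerSeries (Fin 2) ℂ) LocalField (MvPowerSeries.X 0)
    else if i = j + 1 then algebraMap (MvPowerSeries (Fin 2) ℂ) LocalField (MvPowerSeries.X 1)
    else 1 :=
  MvPolynomial.eval₂Hom_X' _ _ _

theorem expandPoly_X_pred (j : ZMod 3) : expandPoly j (MvPolynomial.X (j - 1)) = 1 := by
  rw [expandPoly_X, if_neg (by revert j; decide), if_neg (by revert j; decide)]

theorem expandPoly_cubic (j : ZMod 3) : expandPoly j cubic = 0 := by
  have ht := congrArg (algebraMap (MvPowerSeries (Fin 2) ℂ) LocalField) tSeries_mul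
  simp only [map_mul, map_add, map_pow, map_one] at ht
  have hC : expandPoly j (MvPolynomial.C tK) = KToLocal tK := MvPolynomial.eval₂Hom_C _ _ _
  simp only [cubic, map_sub, map_mul, map_add, map_pow, hC, KToLocal_tK, expandPoly_X]
  rcases zmod_three_cases j with rfl | rfl | rfl
  · rw [if_pos rfl, if_neg (by decide), if_pos (by decide), if_neg (by decide), if_neg (by decide)]
    linear_combination ht
  · rw [if_neg (by decide), if_neg (by decide), if_pos rfl, if_neg (by decide), if_pos (by decide)]
    linear_combination ht
  · rw [if_neg (by decide), if_pos (by decide), if_neg (by decide), if_neg (by decide), if_pos rfl]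
    linear_combination ht

theorem expandPoly_eq_of_toFrac_eq (j : ZMod 3) {P Q : MvPolynomial (ZMod 3) K}
    (h : toFrac P = toFrac Q) : expandPoly j P = expandPoly j Q := by
  have h1 : Ideal.Quotient.mk (Ideal.span {cubic}) P = Ideal.Quotient.mk (Ideal.span {cubic}) Q :=
    IsFractionRing.injective CoordRing (FractionRing CoordRing) h
  obtain ⟨c, hc⟩ := Ideal.mem_span_singleton.mp (Ideal.Quotient.eq.mp h1)
  rw [← sub_eq_zero, ← map_sub, hc, map_mul, expandPoly_cubic, zero_mul]

/-- Independence of the chosen numerator: cross-multiplied representatives agree modulo the cubic,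
which expands to `0`, and `x_{j-1}` expands to `1`. -/
theorem expand_eq (k : ℕ) (j : ZMod 3) (s : H0 k) {P : MvPolynomial (ZMod 3) K} {N : ℕ}
    (h : (s : FractionRing CoordRing) * toFrac (MvPolynomial.X (j - 1)) ^ N = toFrac P) :
    expand k j s = expandPoly j P := by
  obtain ⟨M, -, hM⟩ := (s.2 (j - 1)).choose_spec
  change expandPoly j (s.2 (j - 1)).choose = _
  generalize (s.2 (j - 1)).choose = Q at *
  have := expandPoly_eq_of_toFrac_eq j (P := Q * MvPolynomial.X (j - 1) ^ N)
    (Q := P * MvPolynomial.X (j - 1) ^ M) (by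
      rw [map_mul, map_mul, map_pow, map_pow, ← h, ← hM]
      ring)
  simpa [expandPoly_X_pred] using this

theorem expand_add (k : ℕ) (j : ZMod 3) (s s' : H0 k) :
    expand k j (s + s') = expand k j s + expand k j s' := by
  obtain ⟨P, N, -, hP⟩ := s.2 (j - 1)
  obtain ⟨Q, M, -, hQ⟩ := s'.2 (j - 1)
  rw [expand_eq k j s hP, expand_eq k j s' hQ, expand_eq k j (s + s')
    (P := P * MvPolynomial.X (j - 1) ^ M + Q * MvPolynomial.X (j - 1) ^ N) (N := N + M)]
  · simp [expandPoly_X_pred]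
  · rw [Submodule.coe_add, map_add, map_mul, map_mul, map_pow, map_pow, ← hP, ← hQ]
    ring

theorem expand_smul (k : ℕ) (j : ZMod 3) (a : K) (s : H0 k) :
    expand k j (a • s) = KToLocal a * expand k j s := by
  obtain ⟨P, N, -, hP⟩ := s.2 (j - 1)
  rw [expand_eq k j s hP, expand_eq k j (a • s) (P := MvPolynomial.C a * P) (N := N), map_mul]
  · congr 1
    exact MvPolynomial.eval₂Hom_C _ _ _
  · rw [Submodule.coe_smul, smul_mul_assoc, hP, ← MvPolynomial.smul_eq_C_mul, map_smul]

theorem expand_linearCombination {ι : Type*} (k : ℕ) (j : ZMod 3) (θ : ι → H0 k) (a : ι →₀ K) :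
    expand k j (Finsupp.linearCombination K θ a) =
      ∑ i ∈ a.support, KToLocal (a i) * expand k j (θ i) := by
  let e : H0 k →+ LocalField := AddMonoidHom.mk' (expand k j) (expand_add k j)
  change e _ = _
  rw [Finsupp.linearCombination_apply, Finsupp.sum, map_sum]
  exact Finset.sum_congr rfl fun i _ => expand_smul k j (a i) (θ i)

/-! ### From irrational parameters to all parameters by density. -/

/-- A family of sections is valuatively independent if at the points with irrational parameter the
valuations of its members are finite and pairwise incongruent modulo `ℤ`. -/
theorem valuativelyIndependent_of_irrational {ι : Type*} (k : ℕ) (θ : ι → H0 k)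
    (h0 : ∀ i j, expand k j (θ i) ≠ 0)
    (hne : ∀ j, ∀ r ∈ Set.Icc (0 : ℝ) 1, Irrational r → ∀ i i', i ≠ i' → ∀ n : ℤ,
      localOrd r (expand k j (θ i)) - localOrd r (expand k j (θ i')) ≠ n) :
    ValuativelyIndependent k θ := by
  intro j r hr a
  -- For `a = 0` both sides are `⊤`: the infimum is empty and the section is zero.
  rcases eq_or_ne a 0 with rfl | ha
  · simp only [map_zero, Finsupp.support_zero, Finset.inf_empty]
    have : expand k j 0 = 0 := by simpa using expand_linearCombination k j θ 0
    rw [val, this, localVal_zero hr]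
  have hs : a.support.Nonempty := Finsupp.support_nonempty_iff.mpr ha
  have hirr : Set.EqOn (fun r => val k j r (Finsupp.linearCombination K θ a))
      (fun r => a.support.inf fun i => (((valT (a i) : ℤ) : ℝ) : EReal) + val k j r (θ i))
      (Set.Icc 0 1 ∩ {r | Irrational r}) := by
    rintro r ⟨hr, hrr⟩
    have hK : ∀ i ∈ a.support, KToLocal (a i) ≠ 0 := fun i hi =>
      (map_ne_zero _).mpr (Finsupp.mem_support_iff.mp hi)
    have hord : ∀ i ∈ a.support, localOrd r (KToLocal (a i) * expand k j (θ i)) =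
        valT (a i) + localOrd r (expand k j (θ i)) := fun i hi => by
      rw [localOrd_mul hr hrr (hK i hi) (h0 i j),
        localOrd_KToLocal hr hrr (Finsupp.mem_support_iff.mp hi)]
    obtain ⟨hsum0, hsum⟩ := exists_localOrd_sum_eq hr hrr hs
      (z := fun i => KToLocal (a i) * expand k j (θ i))
      (fun i hi => mul_ne_zero (hK i hi) (h0 i j)) (by
        intro i hi i' hi' hii' h
        rw [hord i hi, hord i' hi'] at h
        refine hne j r hr hrr i i' hii' (valT (a i') - valT (a i)) ?_
        push_cast
        linarith)
    simp only [val]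
    rw [expand_linearCombination, ← coe_localOrd hr hsum0, hsum, ← Finset.inf'_eq_inf hs,
      Finset.apply_inf'_eq_inf'_comp hs Real.toEReal
        (fun x y => EReal.coe_strictMono.monotone.map_min)]
    refine Finset.inf'_congr hs rfl fun i hi => ?_
    rw [Function.comp_apply, hord i hi, EReal.coe_add, coe_localOrd hr (h0 i j)]
  have hdense : Set.Icc (0 : ℝ) 1 ⊆ closure (Set.Icc 0 1 ∩ {r | Irrational r}) := by
    -- Density applies to the open interval, whose closure recovers the endpoints.
    have h := dense_irrational.open_subset_closure_inter (isOpen_Ioo (a := (0 : ℝ)) (b := 1))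
    refine (closure_Ioo (zero_ne_one' ℝ)).symm.subset.trans ?_
    refine closure_minimal (h.trans (closure_mono ?_)) isClosed_closure
    exact Set.inter_subset_inter_left _ Set.Ioo_subset_Icc_self
  refine hirr.of_subset_closure (continuousOn_localVal _) ?_ Set.inter_subset_left hdense hr
  refine ContinuousOn.finset_inf_apply fun i _ => ?_
  -- Addition on `EReal` is not continuous everywhere, so the sum is formed in `ℝ` before coercion.
  have hc : ContinuousOn (fun r => (((valT (a i) + localOrd r (expand k j (θ i)) : ℝ)) : EReal))
      (Set.Icc 0 1) :=
    continuous_coe_real_ereal.comp_continuousOn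
      (continuousOn_const.add (continuousOn_localOrd (h0 i j)))
  refine hc.congr fun r hr => ?_
  beta_reduce
  rw [EReal.coe_add, coe_localOrd hr (h0 i j), val]

end FermatFamily

theorem mainTheorem4 (l : ℚ) (k : ℕ) (hk : 0 < k) (hl : l = k / 3)
    (s : Module.Basis (FermatFamily.bdryLattice l) FermatFamily.K (FermatFamily.H0 k))
    (hs : ∀ (m : FermatFamily.bdryLattice l) (j : ZMod 3) (r : ℝ), r ∈ Set.Icc (0 : ℝ) 1 →
      (((l : ℝ)⁻¹ : ℝ) : EReal) * FermatFamily.val k j r (s m) =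
        ((FermatFamily.cost (m : Fin 2 → ℝ) (FermatFamily.edgePoint j r) : ℝ) : EReal)) :
    FermatFamily.ValuativelyIndependent k (fun m => s m) := by
  have hl0 : 0 < l := by
    rw [hl]
    positivity
  have hlR : (0 : ℝ) < (l : ℝ)⁻¹ := by positivity
  have h0 : ∀ m j, FermatFamily.expand k j (s m) ≠ 0 := by
    intro m j h
    -- A vanishing expansion would have valuation `⊤`, while the cost is a real number; any single
    -- `r` shows this.
    have := hs m j 0 ⟨le_rfl, zero_le_one⟩
    rw [FermatFamily.val, h, FermatFamily.localVal_zero ⟨le_rfl, zero_le_one⟩,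
      EReal.coe_mul_top_of_pos hlR] at this
    exact EReal.coe_ne_top _ this.symm
  have hcost : ∀ m j, ∀ r ∈ Set.Icc (0 : ℝ) 1,
      FermatFamily.localOrd r (FermatFamily.expand k j (s m)) =
        l * FermatFamily.cost (m : Fin 2 → ℝ) (FermatFamily.edgePoint j r) := by
    intro m j r hr
    have := hs m j r hr
    rw [FermatFamily.val, ← FermatFamily.coe_localOrd hr (h0 m j), ← EReal.coe_mul,
      EReal.coe_eq_coe_iff] at this
    rw [← this, mul_inv_cancel_left₀ (inv_pos.mp hlR).ne']
  refine FermatFamily.valuativelyIndependent_of_irrational k _ h0 fun j r hr hirr m m' hmm' n => ?_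
  rw [hcost m j r hr, hcost m' j r hr, ← mul_sub]
  exact ((FermatFamily.irrational_cost_sub_cost m.2 m'.2 (fun h => hmm' (Subtype.ext h)) j hr
    hirr).ratCast_mul hl0.ne').ne_int n
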